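/- Let $a>0$, $S_a=\{z\in\mathbb C : \mathrm{dist}(z,[0,1])<a\}$, and let $\mathcal B$ be a finite-dimensional complex normed space (operators on $\mathcal B$ carry the operator norm). Let $d\ge 0$ be an integer and let $z\mapsto N(z)$ be an analytic family of linear operators on $\mathcal B$, defined on $S_a$, such that $N(z)^d=0$ for every $z\in S_a$. Let $\{A(t)\}_{t\in[0,1]}$ be a continuous family of linear operators on $\mathcal B$. Then there exist $c>0$ and $0<\beta<1$, independent of $\varepsilon$, $s$ and $t$, such that for every $\varepsilon>0$ the problem $$\varepsilon\,\partial_tY(t,s)=(N(t)+\varepsilon A(t))\,Y(t,s),\qquad Y(s,s)=\mathbb I,\qquad s,t\in[0,1],$$ (with one-sided derivatives at $t=0$ and $t=1$) has a solution $Y$, and every solution $Y$ satisfies $$\|Y(t,s)\|\le c\,e^{c/\varepsilon^{\beta}}\qquad\text{for all } s,t\in[0,1].$$ -/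

import Mathlib

/-- The complex neighbourhood `S_a = {z ∈ ℂ | dist (z, [0,1]) < a}` of the real interval `[0,1]`. -/
def complexNhd (a : ℝ) : Set ℂ :=
  {z : ℂ | Metric.infDist z ((fun t : ℝ => (t : ℂ)) '' Set.Icc (0 : ℝ) 1) < a}

/-- `N` is an analytic family of nilpotent operators on `S_a`, with a fixed
exponent `d` such that `N(z)^d = 0` for all `z ∈ S_a`. -/
structure IsAnalyticNilpotent {E : Type*} [NormedAddCommGroup E] [NormedSpace ℂ E]
    (a : ℝ) (d : ℕ) (N : ℂ → E →L[ℂ] E) : Prop where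
  analytic : AnalyticOnNhd ℂ N (complexNhd a)
  pow_eq_zero : ∀ z ∈ complexNhd a, N z ^ d = 0

/-- `Y(t,s)`, `s, t ∈ [0,1]`, solves
`ε ∂_t Y(t,s) = (N(t) + ε A(t)) Y(t,s)`, `Y(s,s) = I`.
The derivative at the end points of `[0,1]` is one-sided. -/
structure IsEvolution {E : Type*} [NormedAddCommGroup E] [NormedSpace ℂ E]
    (N : ℂ → E →L[ℂ] E) (A : ℝ → E →L[ℂ] E) (ε : ℝ) (Y : ℝ → ℝ → E →L[ℂ] E) : Prop where
  hasDeriv : ∀ s ∈ Set.Icc (0 : ℝ) 1, ∀ t ∈ Set.Icc (0 : ℝ) 1,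
    HasDerivWithinAt (fun u : ℝ => Y u s)
      ((ε : ℂ)⁻¹ • ((N (t : ℂ) + (ε : ℂ) • A t) * Y t s)) (Set.Icc (0 : ℝ) 1) t
  initial : ∀ s ∈ Set.Icc (0 : ℝ) 1, Y s s = 1

/-!
The evolution is bounded by comparing `N`, on short intervals, with its value at the left end
point. Analyticity enters only through the fact that `t ↦ N t` is Lipschitz on `[0,1]`.

For a nilpotent `b` with `b ^ (d + 1) = 0` and `0 < δ ≤ 1`, the norm `max_{k ≤ d} δ⁻ᵏ ‖bᵏ z‖` of `z`
dominates `‖z‖`, is at most `(M / δ) ^ d ‖z‖` when `‖b‖ ≤ M` and `M ≥ 1`, and left multiplication by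
`b` has norm at most `δ` for it (`norm_scaledOrbit_mul_le`). On an interval of length `h`,
Grönwall's inequality in the norm attached to `b = N s`, with `s` the left end point, gives the
growth rate `(δ + (M / δ) ^ d (L h + ε α)) / ε`, at the cost of a factor `(M / δ) ^ d` for the
change of norm (`IsSolution.norm_le_of_sub_le`).

Over `[0,1]` about `1 / h` intervals are needed. With `h = δ ^ (d + 1)` the exponent is bounded by a
multiple of `δ / ε + δ ^ (-d) + δ ^ (-(d + 1)) log (M / δ)`, and `δ = ε ^ (1 / (d + 3))` makes this
`O(ε ^ (-β))` with `β = (d + 2) / (d + 3) < 1` (`IsSolution.norm_le_of_le_one`). Values `t < s` are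
reached by reversing time, which replaces `N` and `A` by `-N (1 - t)` and `-A (1 - t)`, and for
`ε ≥ 1` a single interval suffices. Solutions exist because the Dyson series converges
(`exists_hasDerivAt_mul_of_continuous`).
-/

open Set Interval

/-! ### Coefficients and solutions -/

/-- The coefficients of `ε y' = (B + ε A) y` on `[0,1]`: the values of `B` are nilpotent of order
`d + 1` and bounded by `M ≥ 1`, `B` is Lipschitz with constant `L`, and `A` is bounded by `α`.
The exponent is `d + 1`, not `d`, so that it is never zero. -/
structure IsNilpotentSystem {R : Type*} [NormedRing R] (B A : ℝ → R) (d : ℕ) (M L α : ℝ) :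
    Prop where
  one_le : 1 ≤ M
  lip_nonneg : 0 ≤ L
  bound_nonneg : 0 ≤ α
  norm_le : ∀ t ∈ Icc (0 : ℝ) 1, ‖B t‖ ≤ M
  lip : ∀ t ∈ Icc (0 : ℝ) 1, ∀ u ∈ Icc (0 : ℝ) 1, ‖B t - B u‖ ≤ L * |t - u|
  nilpotent : ∀ t ∈ Icc (0 : ℝ) 1, B t ^ (d + 1) = 0
  norm_le' : ∀ t ∈ Icc (0 : ℝ) 1, ‖A t‖ ≤ α

/-- `y` solves `ε y' = (B + ε A) y` on `[0,1]`, with one-sided derivatives at the end points. -/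
def IsSolution {R : Type*} [NormedRing R] [NormedAlgebra ℝ R] (B A : ℝ → R) (ε : ℝ)
    (y : ℝ → R) : Prop :=
  ∀ t ∈ Icc (0 : ℝ) 1, HasDerivWithinAt y (ε⁻¹ • ((B t + ε • A t) * y t)) (Icc 0 1) t

section Estimates

variable {R : Type*} [NormedRing R]

lemma one_sub_mem_Icc_zero_one {t : ℝ} (ht : t ∈ Icc (0 : ℝ) 1) : 1 - t ∈ Icc (0 : ℝ) 1 :=
  ⟨by linarith [ht.2], by linarith [ht.1]⟩

lemma IsNilpotentSystem.reverse {B A : ℝ → R} {d : ℕ} {M L α : ℝ}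
    (h : IsNilpotentSystem B A d M L α) :
    IsNilpotentSystem (fun t => -B (1 - t)) (fun t => -A (1 - t)) d M L α where
  one_le := h.one_le
  lip_nonneg := h.lip_nonneg
  bound_nonneg := h.bound_nonneg
  norm_le t ht := by simpa using h.norm_le _ (one_sub_mem_Icc_zero_one ht)
  lip t ht u hu := by
    have := h.lip _ (one_sub_mem_Icc_zero_one hu) _ (one_sub_mem_Icc_zero_one ht)
    rw [show (1 - u) - (1 - t) = t - u by ring] at this
    rwa [neg_sub_neg]
  nilpotent t ht := by rw [neg_pow, h.nilpotent _ (one_sub_mem_Icc_zero_one ht), mul_zero]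
  norm_le' t ht := by simpa using h.norm_le' _ (one_sub_mem_Icc_zero_one ht)

lemma norm_pow_mul_le {M : ℝ} {b : R} (hb : ‖b‖ ≤ M) (z : R) (k : ℕ) :
    ‖b ^ k * z‖ ≤ M ^ k * ‖z‖ := by
  induction k with
  | zero => simp
  | succ k ih =>
    have hM : 0 ≤ M := (norm_nonneg b).trans hb
    calc ‖b ^ (k + 1) * z‖ = ‖b * (b ^ k * z)‖ := by rw [pow_succ', mul_assoc]
      _ ≤ ‖b‖ * ‖b ^ k * z‖ := norm_mul_le _ _
      _ ≤ M * (M ^ k * ‖z‖) := by gcongr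
      _ = M ^ (k + 1) * ‖z‖ := by ring

variable [NormedAlgebra ℝ R]

lemma IsSolution.reverse {B A : ℝ → R} {ε : ℝ} {y : ℝ → R} (h : IsSolution B A ε y) :
    IsSolution (fun t => -B (1 - t)) (fun t => -A (1 - t)) ε (fun t => y (1 - t)) := by
  intro t ht
  have h1 : HasDerivWithinAt (fun u : ℝ => 1 - u) (-1) (Icc 0 1) t :=
    ((hasDerivAt_id t).const_sub 1).hasDerivWithinAt
  have h2 := HasDerivWithinAt.scomp t (h _ (one_sub_mem_Icc_zero_one ht)) h1
    fun u hu => one_sub_mem_Icc_zero_one hu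
  convert! h2 using 1
  simp only [smul_neg, ← neg_add, neg_mul, neg_smul, one_smul]

/-! ### The rescaled norm of a nilpotent element -/

/-- The vector `(δ⁻ᵏ bᵏ z)` for `k ≤ d`. Its sup norm is, for `b` nilpotent of order `d + 1`, a norm
of `z` for which left multiplication by `b` has norm at most `δ`. -/
noncomputable def scaledOrbit (d : ℕ) (b : R) (δ : ℝ) (z : R) : Fin (d + 1) → R :=
  fun k => δ⁻¹ ^ (k : ℕ) • (b ^ (k : ℕ) * z)

lemma norm_le_norm_scaledOrbit (d : ℕ) (b : R) (δ : ℝ) (z : R) :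
    ‖z‖ ≤ ‖scaledOrbit d b δ z‖ := by
  simpa [scaledOrbit] using norm_le_pi_norm (scaledOrbit d b δ z) 0

lemma norm_scaledOrbit_le {M δ : ℝ} {b : R} (d : ℕ) (hb : ‖b‖ ≤ M) (hM : 1 ≤ M) (hδ : 0 < δ)
    (hδ1 : δ ≤ 1) (z : R) : ‖scaledOrbit d b δ z‖ ≤ (M / δ) ^ d * ‖z‖ := by
  have h1 : 1 ≤ M / δ := (one_le_div hδ).2 (hδ1.trans hM)
  refine (pi_norm_le_iff_of_nonneg (by positivity)).2 fun k => ?_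
  calc ‖δ⁻¹ ^ (k : ℕ) • (b ^ (k : ℕ) * z)‖ = δ⁻¹ ^ (k : ℕ) * ‖b ^ (k : ℕ) * z‖ := by
        rw [norm_smul, Real.norm_of_nonneg (by positivity)]
    _ ≤ δ⁻¹ ^ (k : ℕ) * (M ^ (k : ℕ) * ‖z‖) := by gcongr; exact norm_pow_mul_le hb z _
    _ = (M / δ) ^ (k : ℕ) * ‖z‖ := by rw [div_eq_inv_mul, mul_pow, mul_assoc]
    _ ≤ (M / δ) ^ d * ‖z‖ :=
        mul_le_mul_of_nonneg_right (pow_le_pow_right₀ h1 (Nat.lt_succ_iff.1 k.2)) (norm_nonneg z)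

lemma norm_scaledOrbit_mul_le {d : ℕ} {δ : ℝ} {b : R} (hb : b ^ (d + 1) = 0) (hδ : 0 < δ)
    (z : R) : ‖scaledOrbit d b δ (b * z)‖ ≤ δ * ‖scaledOrbit d b δ z‖ := by
  refine (pi_norm_le_iff_of_nonneg (by positivity)).2 fun k => ?_
  have hk : scaledOrbit d b δ (b * z) k = δ⁻¹ ^ (k : ℕ) • (b ^ ((k : ℕ) + 1) * z) := by
    rw [scaledOrbit, ← mul_assoc, ← pow_succ]
  rw [hk]
  rcases Nat.lt_or_ge ((k : ℕ) + 1) (d + 1) with h | h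
  · calc ‖δ⁻¹ ^ (k : ℕ) • (b ^ ((k : ℕ) + 1) * z)‖
        = ‖δ • scaledOrbit d b δ z ⟨k + 1, h⟩‖ := by
          rw [scaledOrbit, smul_smul, pow_succ δ⁻¹, mul_comm δ, mul_assoc,
            inv_mul_cancel₀ hδ.ne', mul_one]
      _ ≤ δ * ‖scaledOrbit d b δ z‖ := by
          rw [norm_smul, Real.norm_of_nonneg hδ.le]
          gcongr
          exact norm_le_pi_norm _ _
  · rw [pow_eq_zero_of_le h hb, zero_mul, smul_zero, norm_zero]
    positivity

lemma scaledOrbit_add (d : ℕ) (b : R) (δ : ℝ) (z w : R) :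
    scaledOrbit d b δ (z + w) = scaledOrbit d b δ z + scaledOrbit d b δ w := by
  ext k; simp [scaledOrbit, mul_add]

lemma scaledOrbit_smul (d : ℕ) (b : R) (δ r : ℝ) (z : R) :
    scaledOrbit d b δ (r • z) = r • scaledOrbit d b δ z := by
  ext k; simp [scaledOrbit, smul_comm r]

lemma HasDerivWithinAt.scaledOrbit (d : ℕ) (b : R) (δ : ℝ) {y : ℝ → R} {y' : R} {S : Set ℝ}
    {t : ℝ} (h : HasDerivWithinAt y y' S t) :
    HasDerivWithinAt (fun u => scaledOrbit d b δ (y u)) (scaledOrbit d b δ y') S t :=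
  hasDerivWithinAt_pi.2 fun k => (h.const_mul (b ^ (k : ℕ))).const_smul (δ⁻¹ ^ (k : ℕ))

/-! ### Growth estimates -/

/-- On an interval of length `h`, the coefficient `B` is within `L h` of its value at the left end
point, so Grönwall's inequality in the norm rescaled for that value applies. -/
lemma IsSolution.norm_le_of_sub_le {B A : ℝ → R} {d : ℕ} {M L α ε δ h : ℝ} {y : ℝ → R}
    (hy : IsSolution B A ε y) (hS : IsNilpotentSystem B A d M L α) (hε : 0 < ε) (hδ : 0 < δ)
    (hδ1 : δ ≤ 1) {s t : ℝ} (hs : 0 ≤ s) (hst : s ≤ t) (ht : t ≤ 1) (hts : t - s ≤ h) :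
    ‖y t‖ ≤ (M / δ) ^ d *
      Real.exp ((δ + (M / δ) ^ d * (L * h + ε * α)) / ε * (t - s)) * ‖y s‖ := by
  have hM := hS.one_le
  have hL := hS.lip_nonneg
  have hsub : Icc s t ⊆ Icc (0 : ℝ) 1 := Icc_subset_Icc hs ht
  have hs' : s ∈ Icc (0 : ℝ) 1 := hsub ⟨le_rfl, hst⟩
  have key := norm_le_gronwallBound_of_norm_deriv_right_le (a := s) (b := t) (ε := 0)
    (f := fun u => scaledOrbit d (B s) δ (y u))
    (f' := fun u => scaledOrbit d (B s) δ (ε⁻¹ • ((B u + ε • A u) * y u)))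
    (K := (δ + (M / δ) ^ d * (L * h + ε * α)) / ε) (δ := (M / δ) ^ d * ‖y s‖)
    (fun u hu => (((hy u (hsub hu)).scaledOrbit d (B s) δ).continuousWithinAt).mono hsub)
    (fun u hu => (((hy u (hsub (Ico_subset_Icc_self hu))).scaledOrbit d (B s) δ).mono
      hsub).mono_of_mem_nhdsWithin (Icc_mem_nhdsGE_of_mem hu))
    (norm_scaledOrbit_le d (hS.norm_le s hs') hM hδ hδ1 _) ?_ t ⟨hst, le_rfl⟩
  · rw [gronwallBound_ε0] at key
    calc ‖y t‖ ≤ _ := norm_le_norm_scaledOrbit d (B s) δ _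
      _ ≤ _ := key
      _ = _ := by ring
  intro u hu
  have hu' := hsub (Ico_subset_Icc_self hu)
  have hpert : ‖B u - B s + ε • A u‖ ≤ L * h + ε * α := by
    refine (norm_add_le _ _).trans (add_le_add ((hS.lip u hu' s hs').trans ?_) ?_)
    · rw [abs_of_nonneg (sub_nonneg.2 hu.1)]
      gcongr
      linarith [hu.2]
    · rw [norm_smul, Real.norm_of_nonneg hε.le]
      gcongr
      exact hS.norm_le' u hu'
  have hsplit : (B u + ε • A u) * y u = B s * y u + (B u - B s + ε • A u) * y u := by
    rw [← add_mul]; congr 1; abel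
  rw [scaledOrbit_smul, norm_smul, Real.norm_of_nonneg (inv_nonneg.2 hε.le), hsplit,
    scaledOrbit_add, add_zero, div_eq_inv_mul, mul_assoc]
  gcongr
  calc _ ≤ _ := norm_add_le _ _
    _ ≤ δ * ‖scaledOrbit d (B s) δ (y u)‖ + (M / δ) ^ d * ((L * h + ε * α) * ‖y u‖) := by
        gcongr
        · exact norm_scaledOrbit_mul_le (hS.nilpotent s hs') hδ _
        · refine (norm_scaledOrbit_le d (hS.norm_le s hs') hM hδ hδ1 _).trans ?_
          gcongr
          exact (norm_mul_le _ _).trans (by gcongr)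
    _ ≤ δ * ‖scaledOrbit d (B s) δ (y u)‖ +
          (M / δ) ^ d * ((L * h + ε * α) * ‖scaledOrbit d (B s) δ (y u)‖) := by
        have : 0 ≤ L * h + ε * α := (norm_nonneg _).trans hpert
        gcongr
        exact norm_le_norm_scaledOrbit d (B s) δ _
    _ = _ := by ring

/-- Iteration of `IsSolution.norm_le_of_sub_le` over `n` consecutive intervals of length `h`. -/
lemma IsSolution.norm_le_of_sub_le_mul {B A : ℝ → R} {d : ℕ} {M L α ε δ h : ℝ} {y : ℝ → R}
    (hy : IsSolution B A ε y) (hS : IsNilpotentSystem B A d M L α) (hε : 0 < ε) (hδ : 0 < δ)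
    (hδ1 : δ ≤ 1) (hh : 0 ≤ h) {s t : ℝ} (hs : 0 ≤ s) (hst : s ≤ t) (ht : t ≤ 1) (n : ℕ)
    (hts : t - s ≤ n * h) :
    ‖y t‖ ≤ ((M / δ) ^ d) ^ n *
      Real.exp ((δ + (M / δ) ^ d * (L * h + ε * α)) / ε * (t - s)) * ‖y s‖ := by
  have h1 : 1 ≤ (M / δ) ^ d := one_le_pow₀ ((one_le_div hδ).2 (hδ1.trans hS.one_le))
  induction n generalizing t with
  | zero =>
    obtain rfl : t = s := le_antisymm (by simpa using hts) hst
    simp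
  | succ n ih =>
    have hu1 : s ≤ max s (t - h) := le_max_left _ _
    have hu2 : max s (t - h) ≤ t := max_le hst (by linarith)
    have e1 := ih (t := max s (t - h)) hu1 (hu2.trans ht) (by
      push_cast at hts
      rcases max_choice s (t - h) with e | e <;> rw [e]
      · rw [sub_self]; positivity
      · linarith)
    have e2 := hy.norm_le_of_sub_le hS hε hδ hδ1 (h := h) (hs.trans hu1) hu2 ht
      (by linarith [le_max_right s (t - h)])
    set u := max s (t - h)
    set K := (δ + (M / δ) ^ d * (L * h + ε * α)) / ε
    calc ‖y t‖ ≤ (M / δ) ^ d * Real.exp (K * (t - u)) * ‖y u‖ := e2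
      _ ≤ (M / δ) ^ d * Real.exp (K * (t - u)) *
          (((M / δ) ^ d) ^ n * Real.exp (K * (u - s)) * ‖y s‖) := by gcongr
      _ = ((M / δ) ^ d) ^ (n + 1) * (Real.exp (K * (t - u)) * Real.exp (K * (u - s))) * ‖y s‖ := by
          ring
      _ = _ := by rw [← Real.exp_add]; ring_nf

/-- The constant in the exponent of the growth estimate. -/
def growthConst (d : ℕ) (M L α : ℝ) : ℝ :=
  1 + M ^ d * (L + α) + 2 * d * M

lemma pow_le_exp_mul {x : ℝ} (hx : 0 ≤ x) (d : ℕ) : x ^ d ≤ Real.exp (d * x) := by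
  rw [Real.exp_nat_mul]
  exact pow_le_pow_left₀ hx (by linarith [Real.add_one_le_exp x]) d

/-- The choice `δ = ε ^ (1 / (d + 3))`, with intervals of length about `δ ^ (d + 1)`, balances the
growth inside the intervals against the cost of changing the norm from one to the next. -/
lemma IsSolution.norm_le_of_le_one {B A : ℝ → R} {d : ℕ} {M L α δ : ℝ} {y : ℝ → R}
    (hδ : 0 < δ) (hδ1 : δ ≤ 1)
    (hy : IsSolution B A (δ ^ (d + 3)) y) (hS : IsNilpotentSystem B A d M L α)
    {s t : ℝ} (hs : 0 ≤ s) (hst : s ≤ t) (ht : t ≤ 1) :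
    ‖y t‖ ≤ Real.exp (growthConst d M L α / δ ^ (d + 2)) * ‖y s‖ := by
  have hM := hS.one_le
  have hL := hS.lip_nonneg
  have hα := hS.bound_nonneg
  have hpow : 1 ≤ (δ ^ (d + 1))⁻¹ := (one_le_inv₀ (by positivity)).2 (pow_le_one₀ hδ.le hδ1)
  set n := ⌈(δ ^ (d + 1))⁻¹⌉₊
  have hn1 : (δ ^ (d + 1))⁻¹ ≤ n := Nat.le_ceil _
  have hn2 : (n : ℝ) ≤ 2 * (δ ^ (d + 1))⁻¹ := by
    have := Nat.ceil_lt_add_one (zero_le_one.trans hpow); linarith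
  have hn : 1 ≤ n * δ ^ (d + 1) := by
    rwa [inv_le_iff_one_le_mul₀ (by positivity)] at hn1
  have e := hy.norm_le_of_sub_le_mul hS (by positivity) hδ hδ1 (h := δ ^ (d + 1)) (by positivity)
    hs hst ht n (by linarith)
  refine e.trans ?_
  gcongr
  have f1 : ((M / δ) ^ d) ^ n ≤ Real.exp (2 * d * M / δ ^ (d + 2)) := by
    rw [← pow_mul]
    refine (pow_le_exp_mul (by positivity) _).trans (Real.exp_le_exp.2 ?_)
    push_cast
    calc (d : ℝ) * n * (M / δ) ≤ d * (2 * (δ ^ (d + 1))⁻¹) * (M / δ) := by gcongr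
      _ = _ := by field_simp; ring
  have f2 : (δ + (M / δ) ^ d * (L * δ ^ (d + 1) + δ ^ (d + 3) * α)) / δ ^ (d + 3) * (t - s) ≤
      (1 + M ^ d * (L + α)) / δ ^ (d + 2) := by
    calc _ ≤ (δ + (M / δ) ^ d * (L * δ ^ (d + 1) + δ ^ (d + 3) * α)) / δ ^ (d + 3) * 1 := by
          gcongr; linarith
      _ ≤ (δ + (M / δ) ^ d * (L * δ ^ (d + 1) + δ ^ (d + 1) * α)) / δ ^ (d + 3) * 1 := by
          gcongr ((δ + (M / δ) ^ d * (L * δ ^ (d + 1) + ?_ * α)) / δ ^ (d + 3) * 1)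
          exact pow_le_pow_of_le_one hδ.le hδ1 (by omega)
      _ = _ := by rw [div_pow]; field_simp; ring
  calc _ ≤ Real.exp (2 * d * M / δ ^ (d + 2)) *
        Real.exp ((1 + M ^ d * (L + α)) / δ ^ (d + 2)) := by gcongr
    _ = _ := by rw [← Real.exp_add, ← add_div, growthConst]; ring_nf

lemma IsSolution.norm_le_of_one_le {B A : ℝ → R} {d : ℕ} {M L α ε : ℝ} {y : ℝ → R}
    (hy : IsSolution B A ε y) (hS : IsNilpotentSystem B A d M L α) (hε : 1 ≤ ε)
    {s t : ℝ} (hs : 0 ≤ s) (hst : s ≤ t) (ht : t ≤ 1) :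
    ‖y t‖ ≤ M ^ d * Real.exp (growthConst d M L α) * ‖y s‖ := by
  have hM := hS.one_le
  have hL := hS.lip_nonneg
  have hα := hS.bound_nonneg
  have e := hy.norm_le_of_sub_le hS (by linarith) one_pos le_rfl (h := 1) hs hst ht (by linarith)
  refine e.trans ?_
  simp only [div_one, mul_one]
  gcongr
  calc (1 + M ^ d * (L + ε * α)) / ε * (t - s) ≤ (1 + M ^ d * (L + ε * α)) / ε * 1 := by
        gcongr; linarith
    _ = 1 / ε + M ^ d * (L / ε + α) := by field_simp
    _ ≤ 1 + M ^ d * (L + α) := by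
        gcongr
        · exact (div_le_one (by linarith)).2 hε
        · exact div_le_self hL hε
    _ ≤ growthConst d M L α := by rw [growthConst]; linarith [show 0 ≤ 2 * d * M by positivity]

lemma IsSolution.norm_le {B A : ℝ → R} {d : ℕ} {M L α ε : ℝ} {y : ℝ → R}
    (hy : IsSolution B A ε y) (hS : IsNilpotentSystem B A d M L α) (hε : 0 < ε)
    {s t : ℝ} (hs : s ∈ Icc (0 : ℝ) 1) (ht : t ∈ Icc (0 : ℝ) 1) :
    ‖y t‖ ≤ M ^ d * Real.exp (growthConst d M L α) *
      Real.exp (growthConst d M L α / ε ^ ((d + 2 : ℝ) / (d + 3))) * ‖y s‖ := by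
  wlog hst : s ≤ t generalizing B A y s t
  · have := this hy.reverse hS.reverse (one_sub_mem_Icc_zero_one hs)
      (one_sub_mem_Icc_zero_one ht) (by linarith)
    simpa only [sub_sub_cancel] using this
  have hM := hS.one_le
  have hL := hS.lip_nonneg
  have hα := hS.bound_nonneg
  have hC : 0 ≤ growthConst d M L α := by rw [growthConst]; positivity
  rcases le_total ε 1 with h | h
  · have hδ : 0 < ε ^ ((d + 3 : ℝ)⁻¹) := Real.rpow_pos_of_pos hε _
    have e1 : (ε ^ ((d + 3 : ℝ)⁻¹)) ^ (d + 3) = ε := by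
      rw [← Real.rpow_natCast, ← Real.rpow_mul hε.le]
      push_cast
      rw [inv_mul_cancel₀ (by positivity), Real.rpow_one]
    have e2 : (ε ^ ((d + 3 : ℝ)⁻¹)) ^ (d + 2) = ε ^ ((d + 2 : ℝ) / (d + 3)) := by
      rw [← Real.rpow_natCast, ← Real.rpow_mul hε.le]
      push_cast
      rw [div_eq_inv_mul]
    have := IsSolution.norm_le_of_le_one hδ (Real.rpow_le_one hε.le h (by positivity))
      (by rwa [e1]) hS hs.1 hst ht.2
    rw [e2] at this
    refine this.trans ?_
    gcongr
    refine le_mul_of_one_le_left (Real.exp_nonneg _) ?_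
    exact one_le_mul_of_one_le_of_one_le (one_le_pow₀ hM) (Real.one_le_exp hC)
  · refine (hy.norm_le_of_one_le hS h hs.1 hst ht.2).trans ?_
    exact mul_le_mul_of_nonneg_right
      (le_mul_of_one_le_right (by positivity) (Real.one_le_exp (by positivity))) (norm_nonneg _)

end Estimates

/-! ### Solvability of linear equations -/

section Existence

variable {R : Type*} [NormedRing R] [NormedAlgebra ℝ R]

/-- The `n`-th term of the Dyson series of `y' = G y`, `y s = 1`. -/
noncomputable def dysonTerm (G : ℝ → R) (s : ℝ) : ℕ → ℝ → R
  | 0 => fun _ => 1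
  | n + 1 => fun t => ∫ u in s..t, G u * dysonTerm G s n u

lemma continuous_dysonTerm [CompleteSpace R] {G : ℝ → R} (hG : Continuous G) (s : ℝ) (n : ℕ) :
    Continuous (dysonTerm G s n) := by
  induction n with
  | zero => exact continuous_const
  | succ n ih =>
    exact continuous_iff_continuousAt.2 fun t =>
      ((hG.mul ih).integral_hasStrictDerivAt s t).hasDerivAt.continuousAt

lemma hasDerivAt_dysonTerm_succ [CompleteSpace R] {G : ℝ → R} (hG : Continuous G) (s : ℝ) (n : ℕ)
    (t : ℝ) : HasDerivAt (dysonTerm G s (n + 1)) (G t * dysonTerm G s n t) t :=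
  ((hG.mul (continuous_dysonTerm hG s n)).integral_hasStrictDerivAt s t).hasDerivAt

lemma norm_dysonTerm_le [CompleteSpace R] {G : ℝ → R} (hG : Continuous G) {K : ℝ}
    (hK : ∀ t, ‖G t‖ ≤ K) (s : ℝ) (n : ℕ) (t : ℝ) :
    ‖dysonTerm G s n t‖ ≤ ‖(1 : R)‖ * (K ^ n * |t - s| ^ n / n.factorial) := by
  have hK0 : 0 ≤ K := (norm_nonneg _).trans (hK 0)
  induction n generalizing t with
  | zero => simp [dysonTerm]
  | succ n ih =>
    calc ‖dysonTerm G s (n + 1) t‖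
        ≤ ∫ u in Ι s t, ‖G u * dysonTerm G s n u‖ :=
          intervalIntegral.norm_integral_le_integral_norm_uIoc
      _ ≤ ∫ u in Ι s t, (‖(1 : R)‖ * K ^ (n + 1) / n.factorial) * |u - s| ^ n := by
          refine MeasureTheory.setIntegral_mono ?_ ?_ fun u => ?_
          · exact ((hG.mul (continuous_dysonTerm hG s n)).norm.intervalIntegrable s t).def'
          · exact (Continuous.intervalIntegrable (by fun_prop) s t).def'
          · calc ‖G u * dysonTerm G s n u‖ ≤ ‖G u‖ * ‖dysonTerm G s n u‖ := norm_mul_le _ _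
              _ ≤ K * (‖(1 : R)‖ * (K ^ n * |u - s| ^ n / n.factorial)) := by
                  gcongr
                  exacts [hK u, ih u]
              _ = _ := by ring
      _ = _ := by
          rw [MeasureTheory.integral_const_mul, integral_pow_abs_sub_uIoc, Nat.factorial_succ]
          push_cast
          field_simp

lemma exists_hasDerivAt_mul_of_continuous [CompleteSpace R] {G : ℝ → R} (hG : Continuous G) {K : ℝ}
    (hK : ∀ t, ‖G t‖ ≤ K) (s : ℝ) :
    ∃ y : ℝ → R, y s = 1 ∧ ∀ t, HasDerivAt y (G t * y t) t := by
  have hK0 : 0 ≤ K := (norm_nonneg _).trans (hK 0)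
  have hsumm (r : ℝ) : Summable fun n : ℕ => ‖(1 : R)‖ * (K ^ n * r ^ n / n.factorial) := by
    simp_rw [← mul_pow]
    exact (Real.summable_pow_div_factorial (K * r)).mul_left _
  have hterm (t : ℝ) : Summable fun n => dysonTerm G s n t :=
    .of_norm_bounded (hsumm _) fun n => norm_dysonTerm_le hG hK s n t
  have hzero (n : ℕ) : dysonTerm G s (n + 1) s = 0 := by simp [dysonTerm]
  refine ⟨fun t => 1 + ∑' n, dysonTerm G s (n + 1) t, by simp [hzero], fun t => ?_⟩
  have hsum : G t * (1 + ∑' n, dysonTerm G s (n + 1) t) = ∑' n, G t * dysonTerm G s n t := by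
    rw [(hterm t).tsum_mul_left, (hterm t).tsum_eq_zero_add]
    rfl
  rw [hsum]
  -- The derivatives of the terms are summable uniformly on a ball about `s` which contains `t`.
  refine HasDerivAt.const_add 1 (hasDerivAt_tsum_of_isPreconnected
    (u := fun n : ℕ => K * (‖(1 : R)‖ * (K ^ n * (|t - s| + 1) ^ n / n.factorial)))
    (t := Metric.ball s (|t - s| + 1)) (y₀ := s) ((hsumm _).mul_left K) Metric.isOpen_ball
    (convex_ball s _).isPreconnected (fun n u _ => hasDerivAt_dysonTerm_succ hG s n u)
    (fun n u hu => ?_) (Metric.mem_ball_self (by positivity)) ?_ (by simp [Real.dist_eq]))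
  · rw [Metric.mem_ball, Real.dist_eq] at hu
    refine (norm_mul_le _ _).trans ?_
    gcongr
    · exact hK u
    · exact (norm_dysonTerm_le hG hK s n u).trans (by gcongr)
  · simp_rw [hzero]; exact summable_zero

lemma exists_hasDerivWithinAt_mul_of_continuousOn [CompleteSpace R] {G : ℝ → R}
    (hG : ContinuousOn G (Icc 0 1)) (s : ℝ) :
    ∃ y : ℝ → R, y s = 1 ∧
      ∀ t ∈ Icc (0 : ℝ) 1, HasDerivWithinAt y (G t * y t) (Icc 0 1) t := by
  obtain ⟨K, hK⟩ := isCompact_Icc.exists_bound_of_continuousOn hG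
  have h01 : (0 : ℝ) ≤ 1 := zero_le_one
  obtain ⟨y, hy1, hy⟩ := exists_hasDerivAt_mul_of_continuous
    (G := IccExtend h01 ((Icc (0 : ℝ) 1).domRestrict G)) hG.domRestrict.Icc_extend' (K := K)
    (fun t => hK _ (projIcc 0 1 h01 t).2) s
  refine ⟨y, hy1, fun t ht => ?_⟩
  have := hy t
  rw [IccExtend_of_mem h01 _ ht] at this
  exact this.hasDerivWithinAt

end Existence

/-! ### Analytic nilpotent families -/

lemma ofReal_mem_complexNhd {a : ℝ} (ha : 0 < a) {t : ℝ} (ht : t ∈ Icc (0 : ℝ) 1) :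
    (t : ℂ) ∈ complexNhd a := by
  have : Metric.infDist (t : ℂ) ((fun t : ℝ => (t : ℂ)) '' Icc (0 : ℝ) 1) = 0 :=
    Metric.infDist_zero_of_mem (mem_image_of_mem _ ht)
  rw [complexNhd, mem_ofPred_eq, this]
  exact ha

section Family

variable {E : Type*} [NormedAddCommGroup E] [NormedSpace ℂ E]

lemma IsAnalyticNilpotent.continuousOn_ofReal {a : ℝ} (ha : 0 < a) {d : ℕ} {N : ℂ → E →L[ℂ] E}
    (hN : IsAnalyticNilpotent a d N) : ContinuousOn (fun t : ℝ => N t) (Icc 0 1) :=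
  hN.analytic.continuousOn.comp Complex.continuous_ofReal.continuousOn
    fun _ ht => ofReal_mem_complexNhd ha ht

lemma IsAnalyticNilpotent.exists_isNilpotentSystem [CompleteSpace E] {a : ℝ} (ha : 0 < a) {d : ℕ}
    {N : ℂ → E →L[ℂ] E} (hN : IsAnalyticNilpotent a d N) {A : ℝ → E →L[ℂ] E}
    (hA : ContinuousOn A (Icc 0 1)) :
    ∃ M L α : ℝ, IsNilpotentSystem (fun t : ℝ => N t) A d M L α := by
  obtain ⟨M, hM⟩ := isCompact_Icc.exists_bound_of_continuousOn (hN.continuousOn_ofReal ha)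
  obtain ⟨α, hα⟩ := isCompact_Icc.exists_bound_of_continuousOn hA
  have hderiv : ContinuousOn (fun t : ℝ => deriv N t) (Icc 0 1) :=
    hN.analytic.deriv.continuousOn.comp Complex.continuous_ofReal.continuousOn
      fun _ ht => ofReal_mem_complexNhd ha ht
  obtain ⟨L, hL⟩ := isCompact_Icc.exists_bound_of_continuousOn hderiv
  refine ⟨max M 1, max L 0, max α 0, le_max_right _ _, le_max_right _ _, le_max_right _ _,
    fun t ht => (hM t ht).trans (le_max_left _ _), fun t ht u hu => ?_, fun t ht => ?_,
    fun t ht => (hα t ht).trans (le_max_left _ _)⟩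
  · refine (convex_Icc (0 : ℝ) 1).norm_image_sub_le_of_norm_hasDerivWithin_le
      (f := fun t : ℝ => N t) (f' := fun t : ℝ => deriv N t) (fun x hx => ?_)
      (fun x hx => (hL x hx).trans (le_max_left _ _)) hu ht
    have := (hN.analytic _ (ofReal_mem_complexNhd ha hx)).differentiableAt.hasDerivAt.scomp x
      Complex.ofRealCLM.hasDerivAt
    rw [Complex.ofRealCLM_apply, Complex.ofReal_one, one_smul] at this
    exact this.hasDerivWithinAt
  · exact pow_eq_zero_of_le (Nat.le_succ d) (hN.pow_eq_zero _ (ofReal_mem_complexNhd ha ht))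

lemma complex_inv_smul_add_smul_mul (ε : ℝ) (b c z : E →L[ℂ] E) :
    (ε : ℂ)⁻¹ • ((b + (ε : ℂ) • c) * z) = ε⁻¹ • ((b + ε • c) * z) := by
  rw [← Complex.ofReal_inv, Complex.coe_smul, Complex.coe_smul]

lemma IsEvolution.isSolution {N : ℂ → E →L[ℂ] E} {A : ℝ → E →L[ℂ] E} {ε : ℝ}
    {Y : ℝ → ℝ → E →L[ℂ] E} (hY : IsEvolution N A ε Y) {s : ℝ} (hs : s ∈ Icc (0 : ℝ) 1) :
    IsSolution (fun t : ℝ => N t) A ε fun t => Y t s := by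
  intro t ht
  simpa only [complex_inv_smul_add_smul_mul] using hY.hasDeriv s hs t ht

lemma exists_isEvolution [CompleteSpace E] {N : ℂ → E →L[ℂ] E} {A : ℝ → E →L[ℂ] E}
    (hN : ContinuousOn (fun t : ℝ => N t) (Icc 0 1)) (hA : ContinuousOn A (Icc 0 1)) (ε : ℝ) :
    ∃ Y : ℝ → ℝ → E →L[ℂ] E, IsEvolution N A ε Y := by
  have hG : ContinuousOn (fun t : ℝ => (ε : ℂ)⁻¹ • (N t + (ε : ℂ) • A t)) (Icc 0 1) :=
    (hN.add (hA.const_smul (ε : ℂ))).const_smul (ε : ℂ)⁻¹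
  choose Y hY1 hY2 using exists_hasDerivWithinAt_mul_of_continuousOn hG
  refine ⟨fun t s => Y s t, fun s _ t ht => ?_, fun s _ => hY1 s⟩
  simpa only [smul_mul_assoc] using hY2 s t ht

end Family

/-! ### The bound for the evolution -/

theorem mainTheorem3 {E : Type*} [NormedAddCommGroup E] [NormedSpace ℂ E]
    [FiniteDimensional ℂ E] (a : ℝ) (ha : 0 < a) (d : ℕ)
    (N : ℂ → E →L[ℂ] E) (hN : IsAnalyticNilpotent a d N)
    (A : ℝ → E →L[ℂ] E) (hA : ContinuousOn A (Set.Icc (0 : ℝ) 1)) :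
    ∃ c β : ℝ, 0 < c ∧ 0 < β ∧ β < 1 ∧
      ∀ ε : ℝ, 0 < ε →
        (∃ Y : ℝ → ℝ → E →L[ℂ] E, IsEvolution N A ε Y) ∧
        ∀ Y : ℝ → ℝ → E →L[ℂ] E, IsEvolution N A ε Y →
          ∀ t ∈ Set.Icc (0 : ℝ) 1, ∀ s ∈ Set.Icc (0 : ℝ) 1,
            ‖Y t s‖ ≤ c * Real.exp (c / ε ^ β) := by
  have : CompleteSpace E := FiniteDimensional.complete ℂ E
  obtain ⟨M, L, α, hS⟩ := hN.exists_isNilpotentSystem ha hA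
  set C := growthConst d M L α
  have hM : 0 < M := zero_lt_one.trans_le hS.one_le
  refine ⟨max (M ^ d * Real.exp C) C, (d + 2) / (d + 3), lt_max_of_lt_left (by positivity),
    by positivity, (div_lt_one (by positivity)).2 (by linarith), fun ε hε =>
    ⟨exists_isEvolution (hN.continuousOn_ofReal ha) hA ε, fun Y hY t ht s hs => ?_⟩⟩
  have hone : ‖(1 : E →L[ℂ] E)‖ ≤ 1 := ContinuousLinearMap.norm_id_le
  calc ‖Y t s‖ ≤ M ^ d * Real.exp C * Real.exp (C / ε ^ ((d + 2 : ℝ) / (d + 3))) * ‖Y s s‖ :=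
        (hY.isSolution hs).norm_le hS hε hs ht
    _ ≤ M ^ d * Real.exp C * Real.exp (C / ε ^ ((d + 2 : ℝ) / (d + 3))) * 1 := by
        rw [hY.initial s hs]; gcongr
    _ ≤ _ := by
        rw [mul_one]
        gcongr
        · exact le_max_left _ _
        · exact le_max_right _ _
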